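/- Let $\sigma>0$ be fixed. For each $n\ge 1$ let $p=p(n)$ be a dimension, let $\rho=\rho(n)\in\mathbb{R}^{p}$, and let $$x_i = v_i\,\rho + \sigma z_i,\qquad i=1,\dots,n,$$ where the random effects $v_i\sim N(0,1)$ are i.i.d., the noise vectors $z_i\sim N_p(0,I)$ are i.i.d., and $(v_i)_{i\le n}$ is independent of $(z_i)_{i\le n}$. Let $\hat\rho$ be a (measurable) unit eigenvector associated with the largest eigenvalue of the sample covariance matrix $S=n^{-1}\sum_{i=1}^n x_ix_i^T$, and for non-zero vectors let $\angle(\xi,\eta)=\cos^{-1}\bigl(|\xi^T\eta|/(\|\xi\|_2\|\eta\|_2)\bigr)\in[0,\pi/2]$. Assume that, as $n\to\infty$, $p(n)/n\to c$ with $c>0$ and $\|\rho(n)\|_2\to\varrho$ with $\varrho>0$. Then standard PCA is inconsistent: $$\liminf_{n\to\infty} E\,\angle(\hat\rho,\rho)>0 .$$ -/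

import Mathlib

open MeasureTheory ProbabilityTheory Filter Topology

/-- The random elements of a sample of size `n` in dimension `p`: the random effects `v i` are
i.i.d. `N(0,1)`, the noise vectors `z i` are i.i.d. `N_p(0,I)`, and the family of random effects
is independent of the family of noise vectors. -/
structure IsSingleComponentSample {Ω : Type*} [MeasurableSpace Ω] {n p : ℕ} (P : Measure Ω)
    (v : Fin n → Ω → ℝ) (z : Fin n → Ω → EuclideanSpace ℝ (Fin p)) : Prop where
  law_v : ∀ i, HasLaw (v i) (gaussianReal 0 1) P
  law_z : ∀ i, HasLaw (z i) (stdGaussian (EuclideanSpace ℝ (Fin p))) P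
  indep_v : iIndepFun v P
  indep_z : iIndepFun z P
  indep_v_z : IndepFun (fun ω i => v i ω) (fun ω i => z i ω) P

/-- The observations `x i = v i • ρ + σ • z i` of the single component model. -/
noncomputable def observation {n p : ℕ} (ρ : EuclideanSpace ℝ (Fin p)) (σ : ℝ)
    (v : Fin n → ℝ) (z : Fin n → EuclideanSpace ℝ (Fin p)) (i : Fin n) :
    EuclideanSpace ℝ (Fin p) :=
  v i • ρ + σ • z i

/-- The sample covariance matrix `S = n⁻¹ ∑ i, x i (x i)ᵀ` (the mean is known to be zero). -/
noncomputable def sampleCov {n p : ℕ} (x : Fin n → EuclideanSpace ℝ (Fin p)) :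
    Matrix (Fin p) (Fin p) ℝ :=
  (n : ℝ)⁻¹ • ∑ i, Matrix.vecMulVec (x i) (x i)

/-- `ξ` is a unit eigenvector of `S` associated with the largest eigenvalue of `S`. -/
def IsPrincipalUnitEigenvector {p : ℕ} (S : Matrix (Fin p) (Fin p) ℝ)
    (ξ : EuclideanSpace ℝ (Fin p)) : Prop :=
  ‖ξ‖ = 1 ∧ ∃ l : ℝ,
    IsGreatest {μ : ℝ | Module.End.HasEigenvalue (Matrix.toEuclideanLin S) μ} l ∧
    Module.End.HasEigenvector (Matrix.toEuclideanLin S) l ξ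

/-- The angle in `[0, π/2]` between (the lines spanned by) two non-zero vectors. -/
noncomputable def lineAngle {p : ℕ} (ξ η : EuclideanSpace ℝ (Fin p)) : ℝ :=
  Real.arccos (|inner ℝ ξ η| / (‖ξ‖ * ‖η‖))

/-! Let `u = ρ / ‖ρ‖` and let `e j` be an orthonormal basis of the complement of `ρ`. The scores `a
i = ⟨x i, u⟩` give `⟨u, S u⟩ = n⁻¹ ∑ a i ^ 2` and `⟨e j, S u⟩ = n⁻¹ σ ∑ a i ⟨e j, z i⟩`. If the
principal eigenvector is within `ε` of `u` up to sign, then `u` is nearly an eigenvector, so the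
off-axis part of `S u` is small: `∑ ⟨e j, S u⟩ ^ 2 ≤ 16 ε ^ 2 ⟨u, S u⟩ ^ 2`
(`LinearMap.IsPositive.sum_inner_sq_le`).

The noise prevents this. Given the scores, each `∑ a i ⟨e j, z i⟩` is `N(0, ∑ a i ^ 2)`, so its
square reaches `∑ a i ^ 2` with a fixed probability `q` (`gaussianTail_le_measure`). With
probability at least `q / 2` more than `(p - 1) q / 2` of the cross terms do so, while `∑ a i ^ 2`
is of order `n` by Markov. As `p / n` stays away from zero, a small fixed `ε` is contradictory with
probability at least `q / 4`. -/

/-! ### Linear functionals of a standard Gaussian vector -/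

section Gaussian

variable {Ω E : Type*} [MeasurableSpace Ω] {P : Measure Ω} [NormedAddCommGroup E]
  [InnerProductSpace ℝ E] [FiniteDimensional ℝ E] [MeasurableSpace E] [BorelSpace E]

/-- A linear functional of a standard Gaussian vector is a centred Gaussian variable. -/
theorem hasLaw_inner_stdGaussian {z : Ω → E} (hz : HasLaw z (stdGaussian E) P) (w : E) :
    HasLaw (fun ω => inner ℝ w (z ω)) (gaussianReal 0 (‖w‖ ^ 2).toNNReal) P := by
  have h : HasLaw (fun x : E => inner ℝ w x) (gaussianReal 0 (‖w‖ ^ 2).toNNReal)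
      (stdGaussian E) := by
    refine ⟨by fun_prop, ?_⟩
    have h1 := IsGaussian.map_eq_gaussianReal (μ := stdGaussian E) (innerSL ℝ w)
    rw [variance_dual_stdGaussian, integral_strongDual_stdGaussian, innerSL_apply_norm] at h1
    rw [show (fun x : E => inner ℝ w x) = innerSL ℝ w from rfl, h1]
  exact h.fun_comp hz

theorem covariance_inner_stdGaussian {z : Ω → E} (hz : HasLaw z (stdGaussian E) P) (w w' : E) :
    cov[fun ω => inner ℝ w (z ω), fun ω => inner ℝ w' (z ω); P] = inner ℝ w w' := by
  have h1 := hz.covariance_fun_comp (f := fun x => inner ℝ w x) (g := fun x => inner ℝ w' x)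
    (by fun_prop) (by fun_prop)
  rw [h1, ← covarianceBilin_apply_eq_cov IsGaussian.memLp_two_id, covarianceBilin_stdGaussian]
  rfl

end Gaussian

/-- The probability that a standard Gaussian variable is at least one in absolute value. -/
noncomputable def gaussianTail : ℝ := (gaussianReal 0 1).real {x | 1 ≤ x ^ 2}

theorem gaussianTail_pos : 0 < gaussianTail := by
  have : gaussianReal 0 1 (Set.Ioi 1) ≠ 0 := by
    intro h
    have := gaussianReal_absolutelyContinuous' 0 (v := 1) one_ne_zero h
    simp at this
  have h2 : gaussianReal 0 1 {x | 1 ≤ x ^ 2} ≠ 0 := by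
    refine fun h => this (measure_mono_null ?_ h)
    intro x hx
    have : (1 : ℝ) < x := hx
    change 1 ≤ x ^ 2
    nlinarith
  exact ENNReal.toReal_pos h2 (measure_ne_top _ _)

theorem gaussianTail_le_one : gaussianTail ≤ 1 := measureReal_le_one

/-! ### Anti-concentration of Gaussian linear forms -/

section

variable {Ω : Type*} [MeasurableSpace Ω] {P : Measure Ω} {n : ℕ}

/-- Divided by the norm of `a`, the linear form is standard Gaussian; for `a = 0` the event is sure.
-/
theorem gaussianTail_le_pi (a : Fin n → ℝ) :
    ENNReal.ofReal gaussianTail ≤ (Measure.pi fun _ : Fin n => gaussianReal 0 1)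
      {g | ∑ i, a i ^ 2 ≤ (∑ i, a i * g i) ^ 2} := by
  set w : EuclideanSpace ℝ (Fin n) := WithLp.toLp 2 a with hw
  have hnorm : ‖w‖ ^ 2 = ∑ i, a i ^ 2 := by simp [EuclideanSpace.real_norm_sq_eq, hw]
  by_cases h0 : w = 0
  · have : ∑ i, a i ^ 2 = 0 := by rw [← hnorm, h0]; simp
    rw [this]
    simp only [sq_nonneg, Set.ofPred_true, measure_univ]
    exact ENNReal.ofReal_le_one.2 gaussianTail_le_one
  have hpos : 0 < ‖w‖ := norm_pos_iff.2 h0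
  have hlaw : HasLaw (WithLp.toLp 2 : (Fin n → ℝ) → EuclideanSpace ℝ (Fin n))
      (stdGaussian (EuclideanSpace ℝ (Fin n))) (Measure.pi fun _ : Fin n => gaussianReal 0 1) :=
    ⟨by fun_prop, map_pi_eq_stdGaussian⟩
  have h1 := hasLaw_inner_stdGaussian hlaw (‖w‖⁻¹ • w)
  have hv : (‖‖w‖⁻¹ • w‖ ^ 2).toNNReal = 1 := by simp [norm_smul, hpos.ne']
  rw [hv] at h1
  have h2 := h1.measure_eq (p := fun x => 1 ≤ x ^ 2) (measurableSet_le (by fun_prop) (by fun_prop))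
  rw [gaussianTail, measureReal_def, ENNReal.ofReal_toReal (measure_ne_top _ _)]
  refine h2.ge.trans ?_
  refine measure_mono fun g hg => ?_
  simp only [Set.mem_ofPred_eq, real_inner_smul_left] at hg ⊢
  have h3 : inner ℝ w (WithLp.toLp 2 g) = ∑ i, a i * g i := by
    simp [PiLp.inner_apply, hw, mul_comm]
  rw [h3, mul_pow, inv_pow] at hg
  rw [← hnorm]
  have : (1 : ℝ) * ‖w‖ ^ 2 ≤ (‖w‖ ^ 2)⁻¹ * (∑ i, a i * g i) ^ 2 * ‖w‖ ^ 2 := by gcongr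
  field_simp at this
  linarith

/-- Anti-concentration of a linear form in i.i.d. standard Gaussians with random independent
coefficients. -/
theorem gaussianTail_le_measure [IsProbabilityMeasure P] {a g : Ω → Fin n → ℝ}
    (ha : AEMeasurable a P) (hg : HasLaw g (Measure.pi fun _ => gaussianReal 0 1) P)
    (hag : IndepFun a g P) :
    gaussianTail ≤ P.real {ω | ∑ i, a ω i ^ 2 ≤ (∑ i, a ω i * g ω i) ^ 2} := by
  have : IsProbabilityMeasure (P.map a) := Measure.isProbabilityMeasure_map ha
  have hla : HasLaw a (P.map a) P := ⟨ha, rfl⟩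
  have hl := hag.hasLaw_prod hla hg
  have hm : MeasurableSet {x : (Fin n → ℝ) × (Fin n → ℝ) |
      ∑ i, x.1 i ^ 2 ≤ (∑ i, x.1 i * x.2 i) ^ 2} :=
    measurableSet_le (by fun_prop) (by fun_prop)
  have h1 := hl.measure_eq hm
  rw [Measure.prod_apply hm] at h1
  rw [measureReal_def]
  refine (ENNReal.ofReal_le_iff_le_toReal (measure_ne_top _ _)).1 ?_
  refine le_trans ?_ h1.ge
  -- By Fubini, it is enough that the bound is uniform in the frozen coefficients.
  calc ENNReal.ofReal gaussianTail
      = ∫⁻ _, ENNReal.ofReal gaussianTail ∂(P.map a) := by simp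
    _ ≤ _ := lintegral_mono fun x => gaussianTail_le_pi x

end

/-! ### Scores along a direction and noise orthogonal to it -/

namespace IsSingleComponentSample

variable {Ω : Type*} [MeasurableSpace Ω] {n p : ℕ} {P : Measure Ω}
  {v : Fin n → Ω → ℝ} {z : Fin n → Ω → EuclideanSpace ℝ (Fin p)}

theorem hasGaussianLaw (h : IsSingleComponentSample P v z) :
    HasGaussianLaw (fun ω => ((fun i => v i ω), (fun i => z i ω))) P :=
  IndepFun.hasGaussianLaw (h.indep_v.hasGaussianLaw fun i => (h.law_v i).hasGaussianLaw)
    (h.indep_z.hasGaussianLaw fun i => (h.law_z i).hasGaussianLaw) h.indep_v_z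

theorem indepFun_v_z (h : IsSingleComponentSample P v z) (i j : Fin n) :
    IndepFun (v i) (z j) P :=
  h.indep_v_z.comp (measurable_pi_apply i) (measurable_pi_apply j)

/-- Both families are linear images of one Gaussian vector, so vanishing cross-covariances suffice;
for equal indices this is `u ⟂ e`. -/
theorem indepFun_scores [IsProbabilityMeasure P] (h : IsSingleComponentSample P v z) (s σ : ℝ)
    {u e : EuclideanSpace ℝ (Fin p)} (hue : inner ℝ u e = 0) :
    IndepFun (fun ω i => s * v i ω + σ * inner ℝ u (z i ω)) (fun ω i => inner ℝ e (z i ω)) P := by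
  let L : ((Fin n → ℝ) × (Fin n → EuclideanSpace ℝ (Fin p))) →L[ℝ] (Fin n → ℝ) × (Fin n → ℝ) :=
    (ContinuousLinearMap.pi fun i =>
      s • (ContinuousLinearMap.proj i ∘L ContinuousLinearMap.fst ℝ _ _) +
      σ • (innerSL ℝ u ∘L ContinuousLinearMap.proj i ∘L ContinuousLinearMap.snd ℝ _ _)).prod
    (ContinuousLinearMap.pi fun i =>
      innerSL ℝ e ∘L ContinuousLinearMap.proj i ∘L ContinuousLinearMap.snd ℝ _ _)
  have hL := h.hasGaussianLaw.map_fun L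
  refine HasGaussianLaw.indepFun_of_covariance_eval (X := fun i ω => s * v i ω + σ * inner ℝ u (z i ω))
    (Y := fun i ω => inner ℝ e (z i ω)) hL fun i j => ?_
  have hv : MemLp (v i) 2 P := (h.law_v i).hasGaussianLaw.memLp_two
  have hz (w) (k) : MemLp (fun ω => inner ℝ w (z k ω)) 2 P :=
    (hasLaw_inner_stdGaussian (h.law_z k) w).hasGaussianLaw.memLp_two
  refine (covariance_add_left (hv.const_mul s) ((hz u i).const_mul σ) (hz e j)).trans ?_
  rw [covariance_const_mul_left, covariance_const_mul_left]
  have h1 : cov[v i, fun ω => inner ℝ e (z j ω); P] = 0 :=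
    ((h.indepFun_v_z i j).comp measurable_id (φ := id) (ψ := fun x => inner ℝ e x)
      (by fun_prop)).covariance_eq_zero hv (hz e j)
  have h2 : cov[fun ω => inner ℝ u (z i ω), fun ω => inner ℝ e (z j ω); P] = 0 := by
    by_cases hij : i = j
    · subst hij
      rw [covariance_inner_stdGaussian (h.law_z i), hue]
    · exact ((h.indep_z.indepFun hij).comp (φ := fun x => inner ℝ u x)
        (ψ := fun x => inner ℝ e x) (by fun_prop) (by fun_prop)).covariance_eq_zero (hz u i) (hz e j)
  rw [h1, h2]
  ring

theorem hasLaw_score (h : IsSingleComponentSample P v z) (s σ : ℝ)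
    {u : EuclideanSpace ℝ (Fin p)} (hu : ‖u‖ = 1) (i : Fin n) :
    HasLaw (fun ω => s * v i ω + σ * inner ℝ u (z i ω))
      (gaussianReal 0 (s ^ 2 + σ ^ 2).toNNReal) P := by
  have h1 := gaussianReal_const_mul (h.law_v i) s
  have h2 := gaussianReal_const_mul (hasLaw_inner_stdGaussian (h.law_z i) u) σ
  have h3 := gaussianReal_add_gaussianReal_of_indepFun
    (((h.indepFun_v_z i i).comp (φ := fun x => s * x) (ψ := fun x => σ * inner ℝ u x)
      (by fun_prop) (by fun_prop))) h1.map_eq h2.map_eq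
  refine ⟨h1.aemeasurable.add h2.aemeasurable, ?_⟩
  have h4 : (s ^ 2 + σ ^ 2).toNNReal =
      NNReal.mk (s ^ 2) (sq_nonneg s) * 1 + NNReal.mk (σ ^ 2) (sq_nonneg σ) * (‖u‖ ^ 2).toNNReal := by
    ext
    have : 0 ≤ s ^ 2 + σ ^ 2 := by positivity
    simp [hu, this]
  have h5 : s * 0 + σ * 0 = 0 := by ring
  rw [h4, ← h5]
  exact h3

theorem hasLaw_pi_inner (h : IsSingleComponentSample P v z)
    {e : EuclideanSpace ℝ (Fin p)} (he : ‖e‖ = 1) :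
    HasLaw (fun ω i => inner ℝ e (z i ω)) (Measure.pi fun _ : Fin n => gaussianReal 0 1) P := by
  refine iIndepFun.hasLaw_pi (fun i => ?_)
    (h.indep_z.comp (fun _ x => inner ℝ e x) fun _ => by fun_prop)
  simpa [he] using hasLaw_inner_stdGaussian (h.law_z i) e

end IsSingleComponentSample

/-! ### Perturbation of a top eigenvector -/

section Deterministic

variable {E : Type*} [NormedAddCommGroup E] [InnerProductSpace ℝ E]

/-- A positive operator all of whose eigenvalues are at most `l` has norm at most `l`. -/
theorem LinearMap.IsPositive.norm_apply_le [FiniteDimensional ℝ E] {T : E →ₗ[ℝ] E}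
    (hT : T.IsPositive) {l : ℝ} (hl0 : 0 ≤ l)
    (hl : ∀ μ : ℝ, Module.End.HasEigenvalue T μ → μ ≤ l) (w : E) : ‖T w‖ ≤ l * ‖w‖ := by
  refine abs_le_of_sq_le_sq' ?_ (by positivity) |>.2
  set b := hT.isSymmetric.eigenvectorBasis rfl
  rw [mul_pow, ← b.sum_sq_norm_inner_right w, ← b.sum_sq_norm_inner_right (T w), Finset.mul_sum]
  refine Finset.sum_le_sum fun i _ => ?_
  have h1 : inner ℝ (b i) (T w) = hT.isSymmetric.eigenvalues rfl i * inner ℝ (b i) w := by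
    rw [← hT.isSymmetric, hT.isSymmetric.apply_eigenvectorBasis, inner_smul_left]
    rfl
  have h2 : 0 ≤ hT.isSymmetric.eigenvalues rfl i := hT.nonneg_eigenvalues rfl i
  have h3 := hl _ (hT.isSymmetric.hasEigenvalue_eigenvalues rfl i)
  rw [h1, norm_mul, mul_pow, Real.norm_of_nonneg h2]
  gcongr
  exact h3

/-- If a unit vector `u` is close to a top eigenvector of a positive operator, then it is almost
an eigenvector. -/
theorem LinearMap.IsPositive.sum_inner_sq_le {T : E →ₗ[ℝ] E} (hT : T.IsPositive) {l : ℝ}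
    (hl0 : 0 ≤ l) (hl : ∀ w, ‖T w‖ ≤ l * ‖w‖) {ξ u : E} (hξ : ‖ξ‖ = 1) (hu : ‖u‖ = 1)
    (hTξ : T ξ = l • ξ) {ε : ℝ} (hε : ε ≤ 1 / 2) (hd : ‖u - ξ‖ ≤ ε) {m : ℕ} {e : Fin m → E}
    (he : Orthonormal ℝ e) (heu : ∀ j, inner ℝ (e j) u = 0) :
    ∑ j, inner ℝ (e j) (T u) ^ 2 ≤ 16 * ε ^ 2 * inner ℝ u (T u) ^ 2 := by
  obtain ⟨δ, rfl⟩ : ∃ δ, u = ξ + δ := ⟨u - ξ, by abel⟩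
  rw [add_sub_cancel_left] at hd
  have hε0 : 0 ≤ ε := (norm_nonneg _).trans hd
  -- `T - l` kills `ξ`, so only `δ` contributes.
  have h1 : ‖T (ξ + δ) - l • (ξ + δ)‖ ≤ 2 * l * ε := by
    have : T (ξ + δ) - l • (ξ + δ) = T δ - l • δ := by rw [map_add, hTξ, smul_add]; abel
    rw [this]
    calc ‖T δ - l • δ‖ ≤ ‖T δ‖ + ‖l • δ‖ := norm_sub_le _ _
      _ ≤ l * ‖δ‖ + l * ‖δ‖ := by
        rw [norm_smul, Real.norm_of_nonneg hl0]; gcongr; exact hl δ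
      _ ≤ 2 * l * ε := by nlinarith
  have h2 : 2 * inner ℝ ξ δ = -‖δ‖ ^ 2 := by
    have := norm_add_sq_real ξ δ
    rw [hu, hξ] at this
    linarith
  have h3 : inner ℝ (ξ + δ) (T (ξ + δ)) = l * (1 - ‖δ‖ ^ 2) + inner ℝ δ (T δ) := by
    rw [map_add, inner_add_left, inner_add_right, inner_add_right, ← hT.isSymmetric ξ δ, hTξ,
      real_inner_smul_right, real_inner_smul_right, real_inner_smul_left, real_inner_self_eq_norm_sq,
      hξ, real_inner_comm ξ δ]
    linear_combination l * h2
  have h4 : 0 ≤ inner ℝ δ (T δ) := by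
    rw [← hT.isSymmetric]
    exact hT.inner_nonneg_left δ
  have h5 : ‖δ‖ ^ 2 ≤ 1 / 4 := by nlinarith [norm_nonneg δ]
  -- The Rayleigh quotient at `u` is at least `l * (1 - 1 / 4)`; this trades `l` for a quantity
  -- computable from the data.
  have h6 : l ≤ 2 * inner ℝ (ξ + δ) (T (ξ + δ)) := by nlinarith
  -- Subtracting `l • u` is free since `e j ⟂ u`; then Bessel's inequality applies.
  calc ∑ j, inner ℝ (e j) (T (ξ + δ)) ^ 2
      = ∑ j, ‖inner ℝ (e j) (T (ξ + δ) - l • (ξ + δ))‖ ^ 2 := by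
        refine Finset.sum_congr rfl fun j _ => ?_
        rw [inner_sub_right, real_inner_smul_right, heu, mul_zero, sub_zero, Real.norm_eq_abs,
          sq_abs]
    _ ≤ ‖T (ξ + δ) - l • (ξ + δ)‖ ^ 2 := he.sum_inner_products_le _
    _ ≤ (2 * l * ε) ^ 2 := by gcongr
    _ ≤ (2 * (2 * inner ℝ (ξ + δ) (T (ξ + δ))) * ε) ^ 2 := by gcongr
    _ = _ := by ring

end Deterministic

/-! ### The sample covariance operator and the angle between lines -/

theorem toEuclideanLin_sampleCov {n p : ℕ} (x : Fin n → EuclideanSpace ℝ (Fin p))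
    (w : EuclideanSpace ℝ (Fin p)) :
    Matrix.toEuclideanLin (sampleCov x) w = (n : ℝ)⁻¹ • ∑ i, inner ℝ (x i) w • x i := by
  ext k
  simp only [sampleCov, Matrix.toLpLin_apply, Matrix.smul_mulVec, Matrix.sum_mulVec,
    Matrix.vecMulVec_mulVec, PiLp.smul_apply, PiLp.toLp_apply, Pi.smul_apply, Finset.sum_apply,
    WithLp.ofLp_sum, WithLp.ofLp_smul, PiLp.inner_apply, dotProduct]
  simp [mul_comm]

theorem inner_toEuclideanLin_sampleCov {n p : ℕ} (x : Fin n → EuclideanSpace ℝ (Fin p))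
    (w w' : EuclideanSpace ℝ (Fin p)) :
    inner ℝ w (Matrix.toEuclideanLin (sampleCov x) w') =
      (n : ℝ)⁻¹ * ∑ i, inner ℝ (x i) w' * inner ℝ w (x i) := by
  simp [toEuclideanLin_sampleCov, real_inner_smul_right, inner_sum]

theorem isPositive_sampleCov {n p : ℕ} (x : Fin n → EuclideanSpace ℝ (Fin p)) :
    (Matrix.toEuclideanLin (sampleCov x)).IsPositive := by
  refine ⟨fun w w' => ?_, fun w => ?_⟩
  · rw [inner_toEuclideanLin_sampleCov, real_inner_comm, inner_toEuclideanLin_sampleCov]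
    congr 1
    refine Finset.sum_congr rfl fun i _ => ?_
    rw [real_inner_comm w', real_inner_comm w, mul_comm]
  · rw [real_inner_comm, inner_toEuclideanLin_sampleCov]
    simp only [RCLike.re_to_real]
    refine mul_nonneg (by positivity) (Finset.sum_nonneg fun i _ => ?_)
    rw [real_inner_comm]
    exact mul_self_nonneg _

theorem lineAngle_nonneg {p : ℕ} (ξ η : EuclideanSpace ℝ (Fin p)) : 0 ≤ lineAngle ξ η :=
  Real.arccos_nonneg _

/-- One of `ξ` and `-ξ` is at a distance at most the angle of the lines. -/
theorem norm_sub_le_lineAngle {p : ℕ} {ξ η : EuclideanSpace ℝ (Fin p)} (hξ : ‖ξ‖ = 1)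
    (hη : η ≠ 0) :
    ‖‖η‖⁻¹ • η - ξ‖ ≤ lineAngle ξ η ∨ ‖‖η‖⁻¹ • η - -ξ‖ ≤ lineAngle ξ η := by
  have hη' : ‖η‖ ≠ 0 := norm_ne_zero_iff.2 hη
  have key (ζ : EuclideanSpace ℝ (Fin p)) (hζ : ‖ζ‖ = 1) (h : inner ℝ ζ η = |inner ℝ ξ η|) :
      ‖‖η‖⁻¹ • η - ζ‖ ≤ lineAngle ξ η := by
    set t := |inner ℝ ξ η| / (‖ξ‖ * ‖η‖) with ht
    have ht0 : 0 ≤ t := by positivity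
    have ht1 : t ≤ 1 := div_le_one_of_le₀ (abs_real_inner_le_norm ξ η) (by positivity)
    refine abs_le_of_sq_le_sq' ?_ (lineAngle_nonneg ξ η) |>.2
    have h1 : ‖‖η‖⁻¹ • η‖ = 1 := by simp [norm_smul, hη']
    have h2 : inner ℝ (‖η‖⁻¹ • η) ζ = t := by
      rw [real_inner_smul_left, real_inner_comm, h, ht, hξ, one_mul, div_eq_inv_mul]
    rw [norm_sub_sq_real, h1, h2, hζ]
    -- The squared chord is `2 - 2 cos θ`, hence at most `θ ^ 2`.
    have h3 := Real.one_sub_sq_div_two_le_cos (x := lineAngle ξ η)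
    have h4 : Real.cos (lineAngle ξ η) = t := Real.cos_arccos (by linarith) ht1
    rw [h4] at h3
    linarith
  rcases le_total 0 (inner ℝ ξ η) with h | h
  · exact Or.inl (key ξ hξ (abs_of_nonneg h).symm)
  · exact Or.inr (key (-ξ) (by simpa using hξ) (by rw [inner_neg_left, abs_of_nonpos h]))

/-- If the principal eigenvector is close to `ρ`, then the cross terms are small compared with
the squared norm of the scores along `ρ`. -/
theorem IsPrincipalUnitEigenvector.sum_sq_le {n p m : ℕ} (hn : 0 < n)
    {ρ ξ : EuclideanSpace ℝ (Fin p)} (hρ : ρ ≠ 0) {σ : ℝ} {v : Fin n → ℝ}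
    {z : Fin n → EuclideanSpace ℝ (Fin p)}
    (h : IsPrincipalUnitEigenvector (sampleCov (observation ρ σ v z)) ξ) {ε : ℝ} (hε : ε ≤ 1 / 2)
    (hξ : lineAngle ξ ρ < ε) {e : Fin m → EuclideanSpace ℝ (Fin p)} (he : Orthonormal ℝ e)
    (heρ : ∀ j, inner ℝ (e j) ρ = 0) :
    σ ^ 2 * ∑ j, (∑ i, (‖ρ‖ * v i + σ * inner ℝ (‖ρ‖⁻¹ • ρ) (z i)) * inner ℝ (e j) (z i)) ^ 2 ≤
      16 * ε ^ 2 * (∑ i, (‖ρ‖ * v i + σ * inner ℝ (‖ρ‖⁻¹ • ρ) (z i)) ^ 2) ^ 2 := by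
  obtain ⟨hnorm, l, hl, hev⟩ := h
  have hρ' : ‖ρ‖ ≠ 0 := norm_ne_zero_iff.2 hρ
  have hT := isPositive_sampleCov (observation ρ σ v z)
  have hl0 : 0 ≤ l := eigenvalue_nonneg_of_nonneg hl.1 fun w => by
    simpa using hT.re_inner_nonneg_right w
  have hop := hT.norm_apply_le hl0 fun μ hμ => hl.2 hμ
  have hu : ‖‖ρ‖⁻¹ • ρ‖ = 1 := by simp [norm_smul, hρ']
  have heu (j) : inner ℝ (e j) (‖ρ‖⁻¹ • ρ) = 0 := by rw [real_inner_smul_right, heρ, mul_zero]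
  have hTξ := hev.apply_eq_smul
  have h1 : ∑ j, inner ℝ (e j)
      (Matrix.toEuclideanLin (sampleCov (observation ρ σ v z)) (‖ρ‖⁻¹ • ρ)) ^ 2 ≤
      16 * ε ^ 2 * inner ℝ (‖ρ‖⁻¹ • ρ)
        (Matrix.toEuclideanLin (sampleCov (observation ρ σ v z)) (‖ρ‖⁻¹ • ρ)) ^ 2 := by
    rcases norm_sub_le_lineAngle hnorm hρ with hd | hd
    · exact hT.sum_inner_sq_le hl0 hop hnorm hu hTξ hε (hd.trans hξ.le) he heu
    · exact hT.sum_inner_sq_le hl0 hop (by simpa using hnorm) hu (by rw [map_neg, hTξ, smul_neg])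
        hε (hd.trans hξ.le) he heu
  have hxu (i) : inner ℝ (observation ρ σ v z i) (‖ρ‖⁻¹ • ρ) =
      ‖ρ‖ * v i + σ * inner ℝ (‖ρ‖⁻¹ • ρ) (z i) := by
    rw [observation, inner_add_left, real_inner_smul_left, real_inner_smul_left,
      real_inner_comm _ (z i), real_inner_smul_right, real_inner_self_eq_norm_sq]
    field_simp
  have hxe (i j) : inner ℝ (e j) (observation ρ σ v z i) = σ * inner ℝ (e j) (z i) := by
    rw [observation, inner_add_right, real_inner_smul_right, real_inner_smul_right, heρ]
    ring
  have hux (i) : inner ℝ (‖ρ‖⁻¹ • ρ) (observation ρ σ v z i) =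
      ‖ρ‖ * v i + σ * inner ℝ (‖ρ‖⁻¹ • ρ) (z i) := by rw [real_inner_comm, hxu]
  simp only [inner_toEuclideanLin_sampleCov, hxu, hxe, hux] at h1
  set a : Fin n → ℝ := fun i => ‖ρ‖ * v i + σ * inner ℝ (‖ρ‖⁻¹ • ρ) (z i)
  have h2 (j) : ((n : ℝ)⁻¹ * ∑ i, a i * (σ * inner ℝ (e j) (z i))) ^ 2 =
      ((n : ℝ)⁻¹) ^ 2 * (σ ^ 2 * (∑ i, a i * inner ℝ (e j) (z i)) ^ 2) := by
    simp only [mul_left_comm _ σ, ← Finset.mul_sum]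
    ring
  have h3 : ∑ j, ((n : ℝ)⁻¹ * ∑ i, a i * (σ * inner ℝ (e j) (z i))) ^ 2 ≤
    16 * ε ^ 2 * ((n : ℝ)⁻¹ * ∑ i, a i * a i) ^ 2 := h1
  simp only [h2, ← Finset.mul_sum, ← pow_two] at h3
  have hn' : 0 < ((n : ℝ)⁻¹) ^ 2 := by positivity
  refine le_of_mul_le_mul_left (h3.trans_eq ?_) hn'
  ring

/-- If each of `m` events has probability at least `q`, then with probability at least `q / 2`
more than `m * q / 2` of them happen. -/
theorem measureReal_sum_indicator_le {Ω : Type*} [MeasurableSpace Ω] {P : Measure Ω}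
    [IsProbabilityMeasure P] {m : ℕ} (hm : 0 < m) {A : Fin m → Set Ω}
    (hA : ∀ j, NullMeasurableSet (A j) P) {q : ℝ} (hq1 : q ≤ 1)
    (hq : ∀ j, q ≤ P.real (A j)) :
    P.real {ω | ∑ j, (A j).indicator (1 : Ω → ℝ) ω ≤ m * q / 2} ≤ 1 - q / 2 := by
  have hm' : (0 : ℝ) < m := by exact_mod_cast hm
  have hint (j) : Integrable ((A j).indicator (1 : Ω → ℝ)) P :=
    (integrable_const (1 : ℝ)).indicator₀ (hA j)
  have hint' : Integrable (fun ω => ∑ j, (A j).indicator (1 : Ω → ℝ) ω) P :=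
    integrable_finsetSum _ fun j _ => hint j
  -- Markov's inequality is applied to the number of failures, so no independence of the events is
  -- needed. It closes with `1 - q ≤ (1 - q / 2) ^ 2`.
  have hI : ∫ ω, (m - ∑ j, (A j).indicator (1 : Ω → ℝ) ω) ∂P ≤ m * (1 - q) := by
    rw [integral_sub (integrable_const _) hint', integral_finsetSum _ fun j _ => hint j]
    have h1 : (m : ℝ) * q ≤ ∑ j, ∫ ω, (A j).indicator (1 : Ω → ℝ) ω ∂P := by
      calc (m : ℝ) * q = ∑ _j : Fin m, q := by simp
        _ ≤ _ := Finset.sum_le_sum fun j _ => by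
          rw [integral_indicator₀ (hA j)]
          simpa using hq j
    simp only [integral_const, probReal_univ, one_smul]
    linarith
  have hnn (ω : Ω) : 0 ≤ m - ∑ j, (A j).indicator (1 : Ω → ℝ) ω := by
    have : ∑ j, (A j).indicator (1 : Ω → ℝ) ω ≤ ∑ _j : Fin m, (1 : ℝ) :=
      Finset.sum_le_sum fun j _ => Set.indicator_le_self' (fun _ _ => zero_le_one) ω
    simp only [Finset.sum_const, Finset.card_univ, Fintype.card_fin, nsmul_eq_mul, mul_one] at this
    linarith
  have hM := mul_meas_ge_le_integral_of_nonneg (ae_of_all P hnn)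
    ((integrable_const _).sub hint') (m * (1 - q / 2))
  have hset : {ω | (m : ℝ) * (1 - q / 2) ≤ m - ∑ j, (A j).indicator (1 : Ω → ℝ) ω} =
      {ω | ∑ j, (A j).indicator (1 : Ω → ℝ) ω ≤ m * q / 2} := by
    ext ω
    simp only [Set.mem_ofPred_eq]
    constructor <;> intro h <;> linarith
  rw [hset] at hM
  have h2 := hM.trans hI
  rw [mul_assoc] at h2
  have h3 := le_of_mul_le_mul_left h2 hm'
  refine le_of_mul_le_mul_left (h3.trans ?_) (show 0 < 1 - q / 2 by linarith)
  nlinarith [sq_nonneg q]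

/-! ### Probability bounds in the model -/

namespace IsSingleComponentSample

variable {Ω : Type*} [MeasurableSpace Ω] {n p : ℕ} {P : Measure Ω}
  {v : Fin n → Ω → ℝ} {z : Fin n → Ω → EuclideanSpace ℝ (Fin p)}

/-- Markov's inequality: each squared score has mean `s ^ 2 + σ ^ 2`. -/
theorem measureReal_sum_sq_score_ge (h : IsSingleComponentSample P v z) (hn : 0 < n) (s σ : ℝ)
    {u : EuclideanSpace ℝ (Fin p)} (hu : ‖u‖ = 1) {C δ : ℝ} (hC : 0 < C)
    (hCδ : s ^ 2 + σ ^ 2 ≤ C * δ) :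
    P.real {ω | C * n ≤ ∑ i, (s * v i ω + σ * inner ℝ u (z i ω)) ^ 2} ≤ δ := by
  have hn' : (0 : ℝ) < n := by exact_mod_cast hn
  have hL (i) : MemLp (fun ω => s * v i ω + σ * inner ℝ u (z i ω)) 2 P :=
    (h.hasLaw_score s σ hu i).hasGaussianLaw.memLp_two
  have hI (i) : ∫ ω, (s * v i ω + σ * inner ℝ u (z i ω)) ^ 2 ∂P = s ^ 2 + σ ^ 2 := by
    have h1 := h.hasLaw_score s σ hu i
    have h2 := h1.variance_eq
    have h3 := h1.integral_eq
    rw [variance_id_gaussianReal] at h2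
    rw [integral_id_gaussianReal] at h3
    rw [variance_of_integral_eq_zero h1.aemeasurable h3] at h2
    rw [h2, Real.coe_toNNReal _ (by positivity)]
  have hM := mul_meas_ge_le_integral_of_nonneg (μ := P)
    (f := fun ω => ∑ i, (s * v i ω + σ * inner ℝ u (z i ω)) ^ 2)
    (ae_of_all P fun ω => Finset.sum_nonneg fun i _ => sq_nonneg _)
    (integrable_finsetSum _ fun i _ => (hL i).integrable_sq) (C * n)
  rw [integral_finsetSum _ fun i _ => (hL i).integrable_sq] at hM
  simp only [hI, Finset.sum_const, Finset.card_univ, Fintype.card_fin, nsmul_eq_mul] at hM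
  refine le_of_mul_le_mul_left (hM.trans ?_) (show 0 < C * n by positivity)
  nlinarith

/-- Allows one factor `∑ a i ^ 2` to be cancelled when the two bounds on the cross terms are
compared. -/
theorem sum_sq_score_pos (h : IsSingleComponentSample P v z) (hn : 0 < n) (s : ℝ) {σ : ℝ}
    (hσ : 0 < σ) {u : EuclideanSpace ℝ (Fin p)} (hu : ‖u‖ = 1) :
    ∀ᵐ ω ∂P, 0 < ∑ i, (s * v i ω + σ * inner ℝ u (z i ω)) ^ 2 := by
  have h1 := h.hasLaw_score s σ hu ⟨0, hn⟩
  have hv : (s ^ 2 + σ ^ 2).toNNReal ≠ 0 := by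
    simp only [ne_eq, Real.toNNReal_eq_zero, not_le]
    positivity
  have := nullSingletonClass_gaussianReal (μ := 0) hv
  have h2 : ∀ᵐ ω ∂P, s * v ⟨0, hn⟩ ω + σ * inner ℝ u (z ⟨0, hn⟩ ω) ≠ 0 :=
    (h1.ae_iff (p := fun x => x ≠ 0)
      (measurableSet_setOfPred.1 (measurableSet_singleton (0 : ℝ)).compl)).2
      (measure_eq_zero_iff_ae_notMem.1 (measure_singleton 0))
  filter_upwards [h2] with ω hω
  exact Finset.sum_pos' (fun i _ => sq_nonneg _) ⟨⟨0, hn⟩, Finset.mem_univ _, by positivity⟩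

theorem gaussianTail_le_measureReal [IsProbabilityMeasure P] (h : IsSingleComponentSample P v z) (s σ : ℝ)
    {u e : EuclideanSpace ℝ (Fin p)} (he : ‖e‖ = 1) (hue : inner ℝ u e = 0) :
    gaussianTail ≤ P.real {ω | ∑ i, (s * v i ω + σ * inner ℝ u (z i ω)) ^ 2 ≤
      (∑ i, (s * v i ω + σ * inner ℝ u (z i ω)) * inner ℝ e (z i ω)) ^ 2} := by
  have hv (i) := (h.law_v i).aemeasurable
  have hz (i) := (h.law_z i).aemeasurable
  exact gaussianTail_le_measure (a := fun ω i => s * v i ω + σ * inner ℝ u (z i ω))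
    (aemeasurable_pi_lambda _ fun i => by fun_prop) (h.hasLaw_pi_inner he)
    (h.indepFun_scores s σ hue)

/-- With probability bounded below, the angle between the principal eigenvector and `ρ` is at
least `ε`, provided that `ε` is small compared with the ratio of the dimension to the sample
size. -/
theorem le_measureReal_lineAngle [IsProbabilityMeasure P] (h : IsSingleComponentSample P v z) (hn : 0 < n)
    {ρ : EuclideanSpace ℝ (Fin p)} (hρ : ρ ≠ 0) {σ : ℝ} (hσ : 0 < σ)
    {ξ : Ω → EuclideanSpace ℝ (Fin p)}
    (hξ : ∀ᵐ ω ∂P, IsPrincipalUnitEigenvector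
      (sampleCov (observation ρ σ (fun i => v i ω) (fun i => z i ω))) (ξ ω))
    {C ε : ℝ} (hC : 0 < C) (hρC : ‖ρ‖ ^ 2 + σ ^ 2 ≤ C * (gaussianTail / 4)) (hε : ε ≤ 1 / 2)
    (hp : 1 < p) (hεC : 32 * ε ^ 2 * C * n ≤ σ ^ 2 * gaussianTail * (p - 1)) :
    gaussianTail / 4 ≤ P.real {ω | ε ≤ lineAngle (ξ ω) ρ} := by
  set q := gaussianTail
  set m := Module.finrank ℝ (ℝ ∙ ρ)ᗮ with hm
  have hmp : 1 + m = p := by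
    have := Submodule.finrank_add_finrank_orthogonal (ℝ ∙ ρ)
    rwa [finrank_span_singleton hρ, finrank_euclideanSpace_fin] at this
  have hmp' : (p : ℝ) - 1 = m := by rw [← hmp]; push_cast; ring
  rw [hmp'] at hεC
  set b := stdOrthonormalBasis ℝ (ℝ ∙ ρ)ᗮ
  set e : Fin m → EuclideanSpace ℝ (Fin p) := fun j => (b j : EuclideanSpace ℝ (Fin p)) with he_def
  have he : Orthonormal ℝ e := b.orthonormal.comp_linearIsometry (ℝ ∙ ρ)ᗮ.subtypeₗᵢ
  have heρ (j) : inner ℝ (e j) ρ = 0 := by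
    rw [real_inner_comm]
    exact Submodule.mem_orthogonal_singleton_iff_inner_right.1 (b j).2
  set u := ‖ρ‖⁻¹ • ρ with hu_def
  have hu : ‖u‖ = 1 := by simp [hu_def, norm_smul, norm_ne_zero_iff.2 hρ]
  have hue (j) : inner ℝ u (e j) = 0 := by
    rw [real_inner_comm, hu_def, real_inner_smul_right, heρ, mul_zero]
  set a : Ω → Fin n → ℝ := fun ω i => ‖ρ‖ * v i ω + σ * inner ℝ u (z i ω) with ha_def
  have ha (i) : AEMeasurable (fun ω => a ω i) P :=
    (h.hasLaw_score ‖ρ‖ σ hu i).aemeasurable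
  have hz (i) := (h.law_z i).aemeasurable
  set A : Fin m → Set Ω := fun j =>
    {ω | ∑ i, a ω i ^ 2 ≤ (∑ i, a ω i * inner ℝ (e j) (z i ω)) ^ 2} with hA_def
  have hA (j) : NullMeasurableSet (A j) P :=
    nullMeasurableSet_le (Finset.aemeasurable_fun_sum _ fun i _ => (ha i).pow_const 2)
      ((Finset.aemeasurable_fun_sum _ fun i _ => (ha i).mul (by fun_prop)).pow_const 2)
  have hcount := measureReal_sum_indicator_le (by omega) hA gaussianTail_le_one
    fun j => h.gaussianTail_le_measureReal ‖ρ‖ σ (he.1 j) (hue j)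
  have hlarge := h.measureReal_sum_sq_score_ge hn ‖ρ‖ σ hu hC hρC
  have hsub : P.real {ω | lineAngle (ξ ω) ρ < ε} ≤
      P.real ({ω | ∑ j, (A j).indicator (1 : Ω → ℝ) ω ≤ m * q / 2} ∪
        {ω | C * n ≤ ∑ i, a ω i ^ 2}) := by
    refine ENNReal.toReal_mono (measure_ne_top _ _) (measure_mono_ae ?_)
    filter_upwards [hξ, h.sum_sq_score_pos hn ‖ρ‖ hσ hu] with ω hω hpos hlt
    have hlt : lineAngle (ξ ω) ρ < ε := hlt
    by_contra hnot
    have hnot : ¬ (∑ j, (A j).indicator (1 : Ω → ℝ) ω ≤ m * q / 2 ∨ C * n ≤ ∑ i, a ω i ^ 2) := hnot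
    push Not at hnot
    obtain ⟨h1, h2⟩ := hnot
    have h3 := hω.sum_sq_le hn hρ hε hlt he heρ
    have h4 : (∑ j, (A j).indicator (1 : Ω → ℝ) ω) * ∑ i, a ω i ^ 2 ≤
        ∑ j, (∑ i, a ω i * inner ℝ (e j) (z i ω)) ^ 2 := by
      rw [Finset.sum_mul]
      refine Finset.sum_le_sum fun j _ => ?_
      by_cases hj : ω ∈ A j
      · rw [Set.indicator_of_mem hj, Pi.one_apply, one_mul]
        exact hj
      · rw [Set.indicator_of_notMem hj, zero_mul]
        positivity
    have h5 : σ ^ 2 * ∑ j, (∑ i, a ω i * inner ℝ (e j) (z i ω)) ^ 2 ≤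
      16 * ε ^ 2 * (∑ i, a ω i ^ 2) ^ 2 := h3
    have hpos : 0 < ∑ i, a ω i ^ 2 := hpos
    set t := ∑ i, a ω i ^ 2
    set N := ∑ j, (A j).indicator (1 : Ω → ℝ) ω
    have h6 : σ ^ 2 * N ≤ 16 * ε ^ 2 * t := by
      refine le_of_mul_le_mul_right ?_ hpos
      calc σ ^ 2 * N * t = σ ^ 2 * (N * t) := by ring
        _ ≤ _ := (mul_le_mul_of_nonneg_left h4 (sq_nonneg σ)).trans h5
        _ = _ := by ring
    have h7 : σ ^ 2 * (m * q / 2) < σ ^ 2 * N := by gcongr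
    have h8 : 16 * ε ^ 2 * t ≤ 16 * ε ^ 2 * (C * n) := by gcongr
    linarith
  have hunion := measureReal_union_le (μ := P)
    {ω | ∑ j, (A j).indicator (1 : Ω → ℝ) ω ≤ m * q / 2} {ω | C * n ≤ ∑ i, a ω i ^ 2}
  have hcompl : 1 ≤ P.real {ω | lineAngle (ξ ω) ρ < ε} + P.real {ω | ε ≤ lineAngle (ξ ω) ρ} := by
    refine le_trans ?_ (measureReal_union_le _ _)
    have : {ω | lineAngle (ξ ω) ρ < ε} ∪ {ω | ε ≤ lineAngle (ξ ω) ρ} = Set.univ := by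
      ext ω
      simpa using lt_or_ge _ _
    rw [this, probReal_univ]
  -- The bad event has probability at most `(1 - q / 2) + q / 4`.
  linarith

end IsSingleComponentSample

/-! ### From probability to expectation and the limit inferior -/

theorem lineAngle_le_pi {p : ℕ} (ξ η : EuclideanSpace ℝ (Fin p)) : lineAngle ξ η ≤ Real.pi :=
  Real.arccos_le_pi _

theorem integrable_lineAngle {Ω : Type*} [MeasurableSpace Ω] {P : Measure Ω} [IsFiniteMeasure P]
    {p : ℕ} {ξ : Ω → EuclideanSpace ℝ (Fin p)} (hξ : AEMeasurable ξ P)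
    (η : EuclideanSpace ℝ (Fin p)) : Integrable (fun ω => lineAngle (ξ ω) η) P := by
  have hm : Measurable fun x : EuclideanSpace ℝ (Fin p) => lineAngle x η := by
    refine Real.measurable_arccos.comp ?_
    refine Measurable.div ?_ (by fun_prop)
    exact (continuous_abs.comp (continuous_id.inner continuous_const)).measurable
  refine Integrable.of_bound (hm.comp_aemeasurable hξ).aestronglyMeasurable Real.pi
    (ae_of_all _ fun ω => ?_)
  rw [Real.norm_of_nonneg (lineAngle_nonneg _ _)]
  exact lineAngle_le_pi _ _

theorem theorem2
    -- for every sample size, a probability space, a dimension and a component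
    {Ω : ℕ → Type*} [∀ n, MeasurableSpace (Ω n)]
    (P : ∀ n, Measure (Ω n)) [∀ n, IsProbabilityMeasure (P n)]
    (p : ℕ → ℕ) (ρ : ∀ n, EuclideanSpace ℝ (Fin (p n)))
    (σ : ℝ) (hσ : 0 < σ)
    -- the random effects and the noise vectors
    (v : ∀ n, Fin n → Ω n → ℝ)
    (z : ∀ n, Fin n → Ω n → EuclideanSpace ℝ (Fin (p n)))
    (hmodel : ∀ n, IsSingleComponentSample (P n) (v n) (z n))
    -- the asymptotic regime
    (c : ℝ) (hc : 0 < c)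
    (hp : Tendsto (fun n : ℕ => (p n : ℝ) / (n : ℝ)) atTop (𝓝 c))
    (r : ℝ) (hr : 0 < r) (hρ : Tendsto (fun n => ‖ρ n‖) atTop (𝓝 r))
    -- standard PCA: any version of the principal unit eigenvector of the sample covariance
    (ρhat : ∀ n, Ω n → EuclideanSpace ℝ (Fin (p n)))
    (hmeas : ∀ n, AEMeasurable (ρhat n) (P n))
    (hρhat : ∀ᶠ n in atTop, ∀ᵐ ω ∂(P n),
      IsPrincipalUnitEigenvector
        (sampleCov (observation (ρ n) σ (fun i => v n i ω) (fun i => z n i ω))) (ρhat n ω)) :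
    0 < liminf (fun n => ∫ ω, lineAngle (ρhat n ω) (ρ n) ∂(P n)) atTop := by
  have hq := gaussianTail_pos
  set q := gaussianTail
  -- Since `‖ρ n‖ < r + 1` eventually, this makes the Markov bound on the scores equal to `q / 4`.
  set C : ℝ := 4 * ((r + 1) ^ 2 + σ ^ 2) / q with hC_def
  have hC : 0 < C := by positivity
  set ε : ℝ := min (1 / 2) √(σ ^ 2 * q * c / (64 * C)) with hε_def
  have hε0 : 0 < ε := lt_min (by norm_num) (Real.sqrt_pos.2 (by positivity))
  have hεC : 64 * ε ^ 2 * C ≤ σ ^ 2 * q * c := by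
    have h1 : ε ^ 2 ≤ σ ^ 2 * q * c / (64 * C) := by
      rw [← Real.sq_sqrt (show 0 ≤ σ ^ 2 * q * c / (64 * C) by positivity)]
      gcongr
      exact min_le_right _ _
    rw [le_div_iff₀ (by positivity)] at h1
    linarith
  have hev : ∀ᶠ n in atTop, ε * (q / 4) ≤ ∫ ω, lineAngle (ρhat n ω) (ρ n) ∂(P n) := by
    -- Then `1 < c * n / 4`, so `p > 3 * c * n / 4` yields `p - 1 ≥ c * n / 2`; this halving turns
    -- the 32 of the finite-sample bound into the 64 in `ε`.
    have hlarge : ∀ᶠ n : ℕ in atTop, 4 / c < n :=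
      tendsto_natCast_atTop_atTop.eventually_gt_atTop _
    filter_upwards [hρhat, hp.eventually_const_lt (show 3 * c / 4 < c by linarith), hlarge,
      hρ.eventually_const_lt hr, hρ.eventually_lt_const (lt_add_one r)] with n h1 h2 h3 h4 h5
    have hn : (0 : ℝ) < n := lt_trans (by positivity) h3
    rw [lt_div_iff₀ hn] at h2
    rw [div_lt_iff₀ hc] at h3
    have hpn : c / 2 * n ≤ p n - 1 := by linarith
    have hp1 : 1 < p n := by
      have : (1 : ℝ) < p n := by linarith
      exact_mod_cast this
    have hang := (hmodel n).le_measureReal_lineAngle (by exact_mod_cast hn) (norm_pos_iff.1 h4) hσ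
      h1 hC (ε := ε)
      (by
        rw [hC_def]
        have : 4 * ((r + 1) ^ 2 + σ ^ 2) / q * (q / 4) = (r + 1) ^ 2 + σ ^ 2 := by
          field_simp
        change _ ≤ 4 * ((r + 1) ^ 2 + σ ^ 2) / q * (q / 4)
        rw [this]
        gcongr)
      (min_le_left _ _) hp1
      (by
        calc 32 * ε ^ 2 * C * n = 64 * ε ^ 2 * C * (n / 2) := by ring
          _ ≤ σ ^ 2 * q * c * (n / 2) := by gcongr
          _ = σ ^ 2 * q * (c / 2 * n) := by ring
          _ ≤ σ ^ 2 * q * (p n - 1) := by gcongr)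
    exact (mul_le_mul_of_nonneg_left hang hε0.le).trans
      (mul_meas_ge_le_integral_of_nonneg (ae_of_all _ fun ω => lineAngle_nonneg _ _)
        (integrable_lineAngle (hmeas n) _) ε)
  -- A real `liminf` is a supremum with a default value on unbounded sets, so an upper bound on the
  -- expectations is needed.
  have hbdd : IsBoundedUnder (· ≤ ·) atTop fun n => ∫ ω, lineAngle (ρhat n ω) (ρ n) ∂(P n) :=
    isBoundedUnder_of ⟨Real.pi, fun n => by
      calc ∫ ω, lineAngle (ρhat n ω) (ρ n) ∂(P n) ≤ ∫ _, Real.pi ∂(P n) :=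
            integral_mono (integrable_lineAngle (hmeas n) _) (integrable_const _)
              fun ω => lineAngle_le_pi _ _
        _ = Real.pi := by simp⟩
  exact lt_of_lt_of_le (by positivity) (le_liminf_of_le hbdd.isCoboundedUnder_ge hev)
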